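/- All Banach algebras are complex and need not have an identity. Let $A$ be a Banach algebra. A Banach $A$-bimodule is a Banach space $X$ with bilinear left and right actions of $A$ satisfying $(ab)\cdot x=a\cdot(b\cdot x)$, $x\cdot(ab)=(x\cdot a)\cdot b$, $(a\cdot x)\cdot b=a\cdot(x\cdot b)$ and, for some constant $k>0$, $\|a\cdot x\|\le k\|a\|\|x\|$ and $\|x\cdot a\|\le k\|x\|\|a\|$. Its dual $X^*$ is a Banach $A$-bimodule under $\langle x,a\cdot f\rangle=\langle x\cdot a,f\rangle$ and $\langle x,f\cdot a\rangle=\langle a\cdot x,f\rangle$. A derivation from $A$ into a Banach $A$-bimodule $X$ is a continuous linear map $D\colon A\to X$ with $D(ab)=D(a)\cdot b+a\cdot D(b)$ for all $a,b\in A$. It is inner if there is $x\in X$ with $D(a)=a\cdot x-x\cdot a$ for all $a\in A$, and approximately semi-inner if there are nets $(\eta_\alpha)$ and $(\xi_\alpha)$ in $X$, indexed by the same directed set, with $D(a)=\lim_\alpha(a\cdot\eta_\alpha-\xi_\alpha\cdot a)$ in norm for every $a\in A$. The algebra $A$ is amenable if, for each Banach $A$-bimodule $X$, every derivation from $A$ into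 $X^*$ is inner; it is approximately semi-contractible if, for each Banach $A$-bimodule $X$, every derivation from $A$ into $X$ is approximately semi-inner. Every amenable Banach algebra is approximately semi-contractible. The converse fails: the Banach algebra $\ell^2=\ell^2(\mathbb N)$ of square-summable complex sequences, with pointwise operations, is approximately semi-contractible but not amenable. -/

import Mathlib

open Filter Topology
open scoped ENNReal lp

universe u

noncomputable section

/-- The structure of a Banach `A`-bimodule on a Banach space `X`, for a (complex, not necessarily
unital) Banach algebra `A`: `left a x` is `a · x` and `right a x` is `x · a`. Both actions are
bounded bilinear maps, i.e. `‖a · x‖ ≤ k ‖a‖ ‖x‖` and `‖x · a‖ ≤ k ‖x‖ ‖a‖` for some `k`. -/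
structure BanachBimodule (A : Type*) [NonUnitalNormedRing A] [NormedSpace ℂ A]
    (X : Type*) [NormedAddCommGroup X] [NormedSpace ℂ X] where
  left : A →L[ℂ] X →L[ℂ] X
  right : A →L[ℂ] X →L[ℂ] X
  left_mul : ∀ (a b : A) (x : X), left (a * b) x = left a (left b x)
  right_mul : ∀ (a b : A) (x : X), right (a * b) x = right b (right a x)
  left_right : ∀ (a b : A) (x : X), right b (left a x) = left a (right b x)

namespace BanachBimodule

variable {A : Type*} [NonUnitalNormedRing A] [NormedSpace ℂ A]
  {X : Type*} [NormedAddCommGroup X] [NormedSpace ℂ X]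

/-- The dual bimodule structure on the normed dual `X*`:
`⟨x, a · f⟩ = ⟨x · a, f⟩` and `⟨x, f · a⟩ = ⟨a · x, f⟩`. -/
def dual (M : BanachBimodule A X) : BanachBimodule A (StrongDual ℂ X) where
  left := (ContinuousLinearMap.compL ℂ X X ℂ).flip.comp M.right
  right := (ContinuousLinearMap.compL ℂ X X ℂ).flip.comp M.left
  left_mul a b f := by ext x; simp [M.right_mul]
  right_mul a b f := by ext x; simp [M.left_mul]
  left_right a b f := by ext x; simp [M.left_right]

theorem dual_left_apply (M : BanachBimodule A X) (a : A) (f : StrongDual ℂ X) (x : X) :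
    M.dual.left a f x = f (M.right a x) := rfl

theorem dual_right_apply (M : BanachBimodule A X) (a : A) (f : StrongDual ℂ X) (x : X) :
    M.dual.right a f x = f (M.left a x) := rfl

/-- A continuous linear map `D : A → X` is a derivation if `D (ab) = D a · b + a · D b`. -/
def IsDerivation (M : BanachBimodule A X) (D : A →L[ℂ] X) : Prop :=
  ∀ a b : A, D (a * b) = M.right b (D a) + M.left a (D b)

/-- `D` is inner: `D a = a · x - x · a` for some `x`. -/
def IsInner (M : BanachBimodule A X) (D : A →L[ℂ] X) : Prop :=
  ∃ x : X, ∀ a : A, D a = M.left a x - M.right a x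

/-- `D` is approximately semi-inner: there are nets `(η i)` and `(ξ i)` in `X`, over a common
directed set, with `D a = lim (a · η i - ξ i · a)` in norm for every `a`. -/
def IsApproximatelySemiInner {A X : Type u} [NonUnitalNormedRing A] [NormedSpace ℂ A]
    [NormedAddCommGroup X] [NormedSpace ℂ X] (M : BanachBimodule A X) (D : A →L[ℂ] X) : Prop :=
  ∃ (ι : Type u) (_ : Preorder ι) (_ : IsDirectedOrder ι) (_ : Nonempty ι) (η ξ : ι → X),
    ∀ a : A, Tendsto (fun i => M.left a (η i) - M.right a (ξ i)) atTop (𝓝 (D a))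

end BanachBimodule

/-- `A` is amenable: for each Banach `A`-bimodule `X`, every (continuous) derivation from `A` into
the dual bimodule `X*` is inner. -/
def IsAmenable (A : Type u) [NonUnitalNormedRing A] [NormedSpace ℂ A] : Prop :=
  ∀ (X : Type u) [NormedAddCommGroup X] [NormedSpace ℂ X] [CompleteSpace X]
    (M : BanachBimodule A X) (D : A →L[ℂ] StrongDual ℂ X),
    M.dual.IsDerivation D → M.dual.IsInner D

/-- `A` is approximately semi-contractible: for each Banach `A`-bimodule `X`, every (continuous)
derivation from `A` into `X` is approximately semi-inner. -/
def IsApproximatelySemiContractible (A : Type u) [NonUnitalNormedRing A] [NormedSpace ℂ A] :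
    Prop :=
  ∀ (X : Type u) [NormedAddCommGroup X] [NormedSpace ℂ X] [CompleteSpace X]
    (M : BanachBimodule A X) (D : A →L[ℂ] X),
    M.IsDerivation D → M.IsApproximatelySemiInner D

/-! The Banach algebra `ℓ²(ℕ, ℂ)` under pointwise multiplication: its norm and vector space
structure are those of Mathlib. -/

namespace EllTwo

theorem norm_mul_apply_le (f g : ℓ²(ℕ, ℂ)) (i : ℕ) :
    ‖f i * g i‖ ≤ ‖(((‖f‖ : ℝ) : ℂ) • g) i‖ := by
  have h : ‖f i‖ ≤ ‖f‖ := lp.norm_apply_le_norm (by norm_num) f i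
  rw [lp.coeFn_smul, Pi.smul_apply, norm_smul, norm_mul]
  simpa using mul_le_mul_of_nonneg_right h (norm_nonneg (g i))

theorem memℓp_mul (f g : ℓ²(ℕ, ℂ)) : Memℓp (fun i => f i * g i) 2 :=
  (lp.memℓp (((‖f‖ : ℝ) : ℂ) • g)).mono' (norm_mul_apply_le f g)

instance instMul : Mul ℓ²(ℕ, ℂ) where
  mul f g := ⟨fun i => f i * g i, memℓp_mul f g⟩

@[simp]
theorem mul_apply (f g : ℓ²(ℕ, ℂ)) (i : ℕ) : (f * g) i = f i * g i := rfl

instance instNonUnitalNormedRing : NonUnitalNormedRing ℓ²(ℕ, ℂ) :=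
  { lp.normedAddCommGroup with
    left_distrib := fun f g h => lp.ext <| funext fun i => mul_add (f i) (g i) (h i)
    right_distrib := fun f g h => lp.ext <| funext fun i => add_mul (f i) (g i) (h i)
    zero_mul := fun f => lp.ext <| funext fun i => zero_mul (f i)
    mul_zero := fun f => lp.ext <| funext fun i => mul_zero (f i)
    mul_assoc := fun f g h => lp.ext <| funext fun i => mul_assoc (f i) (g i) (h i)
    norm_mul_le := fun f g => by
      refine (lp.norm_mono (by norm_num) (norm_mul_apply_le f g)).trans ?_
      rw [norm_smul]
      simp }

instance instIsScalarTower : IsScalarTower ℂ ℓ²(ℕ, ℂ) ℓ²(ℕ, ℂ) where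
  smul_assoc c f g := lp.ext <| funext fun i => mul_assoc c (f i) (g i)

instance instSMulCommClass : SMulCommClass ℂ ℓ²(ℕ, ℂ) ℓ²(ℕ, ℂ) where
  smul_comm c f g := lp.ext <| funext fun i => mul_left_comm c (f i) (g i)

end EllTwo

end

/-! If `A` is amenable, a derivation into `X`, viewed in `X**`, is implemented by some `Φ`. On each
finite subset of `A`, Hahn–Banach replaces `Φ` by elements of `X` up to `ε`; finite sets and
tolerances index the net, with `η = ξ`.

In `ℓ²` the projections `pₙ` form an approximate identity, and `D (pₙ a)` has the form `a · ηₙ - ξₙ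
· a` exactly. But `‖pₙ‖ = √n` is unbounded, and this defeats amenability: the pairing `∑ aᵢ xᵢ` is a
derivation which, if inner, would give `n ≤ ‖f‖ √n` for all `n`. -/

/-- A vector annihilated by every continuous functional vanishing on a subspace lies in the closure
of that subspace. -/
theorem Submodule.mem_topologicalClosure_of_forall_dual {E : Type*} [NormedAddCommGroup E]
    [NormedSpace ℂ E] (S : Submodule ℂ E) (x : E)
    (h : ∀ f : StrongDual ℂ E, (∀ y ∈ S, f y = 0) → f x = 0) : x ∈ S.topologicalClosure := by
  by_contra hx
  have : IsClosed (S.topologicalClosure : Set E) := S.isClosed_topologicalClosure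
  have hne : S.topologicalClosure.mkQ x ≠ 0 := by simpa using hx
  obtain ⟨f, hf⟩ := SeparatingDual.exists_ne_zero (R := ℂ) hne
  refine hf (h (f.comp S.topologicalClosure.mkQL) fun y hy => ?_)
  have : S.topologicalClosure.mkQL y = 0 := by
    simpa using S.le_topologicalClosure hy
  simp [this]

namespace BanachBimodule

variable {A : Type*} [NonUnitalNormedRing A] [NormedSpace ℂ A]
  {X : Type*} [NormedAddCommGroup X] [NormedSpace ℂ X]

/-- A derivation into `X`, regarded as a map into `X**`, is a derivation. -/
theorem IsDerivation.bidual {M : BanachBimodule A X} {D : A →L[ℂ] X} (hD : M.IsDerivation D) :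
    M.dual.dual.IsDerivation ((NormedSpace.inclusionInDoubleDual ℂ X).comp D) := by
  intro a b
  ext f
  simp [hD a b, dual_left_apply, dual_right_apply]

/-- If `D : A → X` becomes inner in `X**`, then on finitely many elements of `A` it is a norm limit
of inner derivations of `X`. -/
theorem exists_norm_sub_lt_of_isInner_bidual {M : BanachBimodule A X} {D : A →L[ℂ] X}
    (hD : M.dual.dual.IsInner ((NormedSpace.inclusionInDoubleDual ℂ X).comp D))
    (F : Finset A) {ε : ℝ} (hε : 0 < ε) :
    ∃ x : X, ∀ a ∈ F, ‖M.left a x - M.right a x - D a‖ < ε := by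
  classical
  obtain ⟨Φ, hΦ⟩ := hD
  let T : X →L[ℂ] (F → X) := ContinuousLinearMap.pi fun a => M.left a - M.right a
  have hmem : (fun a : F => D a) ∈ T.range.topologicalClosure := by
    -- A functional on `X^F` is a family `G a`. Vanishing on the range of `T` means `∑ (G a · a - a
    -- · G a) = 0`, and `Φ` sends this sum to `∑ G a (D a)`.
    refine Submodule.mem_topologicalClosure_of_forall_dual _ _ fun g hg => ?_
    let G : F → StrongDual ℂ X := fun a => g.comp (ContinuousLinearMap.single ℂ (fun _ => X) a)
    have hsum : ∀ v : F → X, ∑ a, G a (v a) = g v := fun v =>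
      ContinuousLinearMap.sum_comp_single ℂ (fun _ => X) g v
    have hzero : ∑ a : F, ((G a).comp (M.left a) - (G a).comp (M.right a)) = 0 := by
      ext x
      have := (hsum (T x)).trans (hg _ ⟨x, rfl⟩)
      simpa [T] using this
    have hval : ∀ a : F, G a (D a) = Φ ((G a).comp (M.left a) - (G a).comp (M.right a)) := by
      intro a
      rw [map_sub]
      exact congrArg (fun Ψ : StrongDual ℂ (StrongDual ℂ X) => Ψ (G a)) (hΦ a)
    rw [← hsum, Finset.sum_congr rfl fun a _ => hval a, ← map_sum, hzero, map_zero]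
  obtain ⟨_, ⟨x, rfl⟩, hx⟩ := Metric.mem_closure_iff.1 hmem ε hε
  refine ⟨x, fun a ha => ?_⟩
  rw [dist_comm, dist_pi_lt_iff hε] at hx
  simpa [T, dist_eq_norm] using hx ⟨a, ha⟩

end BanachBimodule

theorem IsAmenable.isApproximatelySemiContractible {A : Type u} [NonUnitalNormedRing A]
    [NormedSpace ℂ A] (hA : IsAmenable A) : IsApproximatelySemiContractible A := by
  intro X _ _ _ M D hD
  -- Amenability is applied to the bimodule `X*`, whose dual is `X**`.
  have hin := hA (StrongDual ℂ X) M.dual _ hD.bidual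
  choose x hx using fun i : Finset A × ℕ =>
    BanachBimodule.exists_norm_sub_lt_of_isInner_bidual hin i.1
      (Nat.one_div_pos_of_nat (α := ℝ) (n := i.2))
  classical
  refine ⟨Finset A × ℕ, inferInstance, inferInstance, inferInstance, x, x, fun a => ?_⟩
  rw [Metric.tendsto_atTop]
  intro ε hε
  obtain ⟨n, hn⟩ := exists_nat_one_div_lt hε
  refine ⟨({a}, n), fun i hi => ?_⟩
  rw [dist_eq_norm]
  exact (hx i a (hi.1 (Finset.mem_singleton_self a))).trans_le
    ((Nat.one_div_le_one_div hi.2).trans hn.le)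

namespace EllTwo

/-- The standard unit vectors of `ℓ²`. -/
noncomputable def unitVec (i : ℕ) : ℓ²(ℕ, ℂ) := lp.single 2 i 1

theorem mul_comm' (f g : ℓ²(ℕ, ℂ)) : f * g = g * f :=
  lp.ext <| funext fun i => mul_comm (f i) (g i)

theorem unitVec_mul (i : ℕ) (f : ℓ²(ℕ, ℂ)) : unitVec i * f = f i • unitVec i := by
  ext j
  by_cases h : j = i
  · subst h; simp [unitVec]
  · simp [unitVec, h]

theorem unitVec_mul_self (i : ℕ) : unitVec i * unitVec i = unitVec i := by
  rw [unitVec_mul]; simp [unitVec]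

/-- The projections `e₀ + ⋯ + eₙ₋₁`. -/
noncomputable def proj (n : ℕ) : ℓ²(ℕ, ℂ) := ∑ i ∈ Finset.range n, unitVec i

theorem proj_mul (n : ℕ) (f : ℓ²(ℕ, ℂ)) :
    proj n * f = ∑ i ∈ Finset.range n, f i • unitVec i := by
  simp only [proj, Finset.sum_mul, unitVec_mul]

theorem tendsto_proj_mul (f : ℓ²(ℕ, ℂ)) : Tendsto (fun n => proj n * f) atTop (𝓝 f) := by
  have h := (lp.hasSum_single (by norm_num) f).tendsto_sum_nat
  refine h.congr fun n => ?_
  rw [proj_mul]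
  refine Finset.sum_congr rfl fun i _ => ?_
  rw [unitVec, ← lp.single_smul]
  simp

theorem proj_mul_self (n : ℕ) : proj n * proj n = proj n := by
  rw [proj_mul, proj]
  refine Finset.sum_congr rfl fun i hi => ?_
  have : (∑ j ∈ Finset.range n, unitVec j) i = 1 := by
    rw [lp.coeFn_sum, Finset.sum_apply, Finset.sum_eq_single i]
    · simp [unitVec]
    · intro j _ hj
      simp [unitVec, hj.symm]
    · exact fun h => (h hi).elim
  rw [this, one_smul]

theorem norm_proj_sq (n : ℕ) : ‖proj n‖ ^ 2 = n := by
  have h := lp.norm_sum_single (p := 2) (E := fun _ : ℕ => ℂ) (by norm_num) (fun _ => 1)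
    (Finset.range n)
  simpa [proj, unitVec] using h

section Derivation

variable {X : Type*} [NormedAddCommGroup X] [NormedSpace ℂ X]
  (M : BanachBimodule ℓ²(ℕ, ℂ) X) (D : ℓ²(ℕ, ℂ) →L[ℂ] X)

/-- The element `∑ eᵢ · D eᵢ` which implements `D` on the span of `e₀, …, eₙ₋₁`. -/
noncomputable def implementer (n : ℕ) : X := ∑ i ∈ Finset.range n, M.left (unitVec i) (D (unitVec i))

variable {M D}

/-- Expanding `D (eᵢ a) = aᵢ D eᵢ` gives `D eᵢ · a = aᵢ D eᵢ - eᵢ · D a`. Acting by `eᵢ` on the left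
and using `a eᵢ = aᵢ eᵢ` isolates `eᵢ · D a`. -/
theorem left_proj_derivation (hD : M.IsDerivation D) (n : ℕ) (a : ℓ²(ℕ, ℂ)) :
    M.left (proj n) (D a) = M.left a (implementer M D n) - M.right a (implementer M D n) := by
  simp only [implementer, proj, map_sum, sum_apply, ← Finset.sum_sub_distrib]
  refine Finset.sum_congr rfl fun i _ => ?_
  have h := hD (unitVec i) a
  rw [unitVec_mul, map_smul] at h
  have h' : M.right a (D (unitVec i)) = a i • D (unitVec i) - M.left (unitVec i) (D a) :=
    eq_sub_of_add_eq h.symm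
  rw [M.left_right, h', map_sub, map_smul, ← M.left_mul, ← M.left_mul, mul_comm' a, unitVec_mul,
    unitVec_mul_self, map_smul, smul_apply, sub_sub_cancel]

/-- The Leibniz rule adds `D pₙ · a` to `pₙ · D a`; absorbing it into the right-hand net is what
makes the two nets differ. -/
theorem derivation_proj_mul (hD : M.IsDerivation D) (n : ℕ) (a : ℓ²(ℕ, ℂ)) :
    D (proj n * a) =
      M.left a (implementer M D n) - M.right a (implementer M D n - D (proj n)) := by
  rw [hD, left_proj_derivation hD, map_sub]
  abel

end Derivation

theorem isApproximatelySemiContractible : IsApproximatelySemiContractible ℓ²(ℕ, ℂ) := by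
  intro X _ _ _ M D hD
  refine ⟨ℕ, inferInstance, inferInstance, inferInstance, fun n => implementer M D n,
    fun n => implementer M D n - D (proj n), fun a => ?_⟩
  exact ((D.continuous.tendsto a).comp (tendsto_proj_mul a)).congr
    fun n => derivation_proj_mul hD n a

/-- The bimodule `ℓ²` with zero left action and right action given by multiplication. -/
noncomputable def mulRight : BanachBimodule ℓ²(ℕ, ℂ) ℓ²(ℕ, ℂ) where
  left := 0
  right := ContinuousLinearMap.mul ℂ ℓ²(ℕ, ℂ)
  left_mul a b x := by simp
  right_mul a b x := by simp [mul_comm' a b, mul_assoc]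
  left_right a b x := by simp

/-- The bilinear pairing `⟨a, x⟩ = ∑ aᵢ xᵢ` of `ℓ²` with itself. -/
noncomputable def pairing : ℓ²(ℕ, ℂ) →L[ℂ] StrongDual ℂ ℓ²(ℕ, ℂ) :=
  (innerSL ℂ).comp (starL ℂ : ℓ²(ℕ, ℂ) ≃L⋆[ℂ] ℓ²(ℕ, ℂ)).toContinuousLinearMap

theorem pairing_apply (a x : ℓ²(ℕ, ℂ)) : pairing a x = ∑' i, a i * x i := by
  have : pairing a x = inner ℂ (star a) x := rfl
  rw [this, lp.inner_eq_tsum]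
  simp [mul_comm]

/-- The dual right action is zero, so the Leibniz rule reduces to `⟨ab, x⟩ = ⟨b, ax⟩`. -/
theorem pairing_isDerivation : mulRight.dual.IsDerivation pairing := by
  intro a b
  ext x
  simp [BanachBimodule.dual_left_apply, BanachBimodule.dual_right_apply, mulRight, pairing_apply,
    mul_assoc, mul_left_comm]

theorem pairing_proj (n : ℕ) : pairing (proj n) (proj n) = n := by
  have hp : star (proj n) = proj n := by
    simp only [proj, star_sum]
    refine Finset.sum_congr rfl fun i _ => lp.ext <| funext fun j => ?_
    by_cases h : j = i
    · subst h; simp [unitVec]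
    · simp [unitVec, h]
  have : pairing (proj n) (proj n) = inner ℂ (star (proj n)) (proj n) := rfl
  rw [this, hp, inner_self_eq_norm_sq_to_K, ← RCLike.ofReal_pow, norm_proj_sq]
  simp

theorem not_isAmenable : ¬ IsAmenable ℓ²(ℕ, ℂ) := by
  intro h
  -- Innerness here says `⟨a, x⟩ = f (a x)`; it is tested at `a = x = pₙ` with `n > ‖f‖²`.
  obtain ⟨f, hf⟩ := h _ mulRight pairing pairing_isDerivation
  obtain ⟨n, hn⟩ := exists_nat_gt (‖f‖ ^ 2)
  have h1 : pairing (proj n) (proj n) = f (proj n) := by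
    rw [hf, sub_apply, BanachBimodule.dual_left_apply,
      BanachBimodule.dual_right_apply]
    simp [mulRight, proj_mul_self]
  have h2 : (n : ℝ) ≤ ‖f‖ * ‖proj n‖ := by
    have := f.le_opNorm (proj n)
    rwa [← h1, pairing_proj, Complex.norm_natCast] at this
  have h3 := norm_proj_sq n
  have h4 : ‖proj n‖ ≤ ‖f‖ := by
    -- Cancelling `‖pₙ‖` from `‖pₙ‖² ≤ ‖f‖ ‖pₙ‖` requires it to be nonzero.
    rcases (norm_nonneg (proj n)).eq_or_lt with h0 | h0
    · rw [← h0]; exact norm_nonneg f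
    · refine le_of_mul_le_mul_right ?_ h0
      rwa [← pow_two, h3]
  exact absurd (pow_le_pow_left₀ (norm_nonneg _) h4 2) (by rw [h3]; exact not_le.2 hn)

end EllTwo

theorem corollary2p15 :
    (∀ (A : Type u) [NonUnitalNormedRing A] [NormedSpace ℂ A] [IsScalarTower ℂ A A]
      [SMulCommClass ℂ A A] [CompleteSpace A],
      IsAmenable A → IsApproximatelySemiContractible A) ∧
    (IsApproximatelySemiContractible ℓ²(ℕ, ℂ) ∧ ¬ IsAmenable ℓ²(ℕ, ℂ)) :=
  ⟨fun _ => IsAmenable.isApproximatelySemiContractible,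
    EllTwo.isApproximatelySemiContractible, EllTwo.not_isAmenable⟩
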